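/- Let $\sigma$ be a finite tree whose leaves (the vertices of degree $1$) are labeled bijectively by $1,\dots,n$. Let $V(\sigma)$ be the set of non-leaf vertices, $L(\sigma)$ the set of leaf-edges (edges containing a leaf), and $E^{\circ}(\sigma)$ the set of remaining edges. Choose a direction on each edge of $\sigma$ so that every leaf-edge points toward its leaf. (Such a choice exists unless $\sigma$ is a single edge joining two leaves; that tree is excluded. The choice is otherwise arbitrary.) Over $\mathbb{C}$, put $$M(\sigma)=\prod_{e\in E^{\circ}(\sigma)}\mathrm{SL}_2\times\prod_{\ell\in L(\sigma)}\mathbb{A}^2,\qquad G(\sigma)=\prod_{v\in V(\sigma)}\mathrm{SL}_2,$$ and let $G(\sigma)$ act on $M(\sigma)$ as follows: $g=(g_v)_v$ sends the component $m_e\in\mathrm{SL}_2$ at a non-leaf edge $e$ directed from $u$ to $w$ to $g_u m_e g_w^{-1}$, and the component $x_\ell\in\mathbb{A}^2$ at a leaf-edge $\ell$ whose non-leaf endpoint is $u$ to $g_u x_\ell$. Let $X\subset\mathbb{A}^{\binom n2}$ be the affine cone over the Pl\"ucker embedding of the Grassmannian $\mathrm{Gr}_2(\mathbb{C}^n)$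 of $2$-planes in $\mathbb{C}^n$, with its reduced structure (a point if $n<2$). Then for every such $\sigma$ and every such choice of directions, the GIT quotient $M(\sigma)/\!/G(\sigma)=\operatorname{Spec}\,\mathbb{C}[M(\sigma)]^{G(\sigma)}$ is isomorphic to $X$ as a scheme over $\mathbb{C}$. -/

import Mathlib

open CategoryTheory AlgebraicGeometry

namespace TreeGIT

/-! ### Oriented trees -/

section Trees

variable {V : Type}

/-- A leaf of a graph: a vertex with exactly one neighbour. -/
def IsLeaf (σ : SimpleGraph V) (v : V) : Prop :=
  (σ.neighborSet v).ncard = 1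

/-- The non-leaf vertices of `σ`. -/
abbrev InnerVertex (σ : SimpleGraph V) : Type :=
  {v : V // ¬ IsLeaf σ v}

/-- An edge is a leaf-edge if one of its end points is a leaf. -/
def IsLeafEdge (σ : SimpleGraph V) (e : σ.edgeSet) : Prop :=
  ∃ v ∈ e.1, IsLeaf σ v

/-- The set `L(σ)` of leaf-edges. -/
abbrev LeafEdge (σ : SimpleGraph V) : Type :=
  {e : σ.edgeSet // IsLeafEdge σ e}

/-- The set `E°(σ)` of non-leaf edges. -/
abbrev InnerEdge (σ : SimpleGraph V) : Type :=
  {e : σ.edgeSet // ¬ IsLeafEdge σ e}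

/-- A choice of direction, from `tail e` to `head e`, on each edge `e`, such that each edge
containing a leaf points toward that leaf. -/
structure LeafOrientation (σ : SimpleGraph V) where
  tail : σ.edgeSet → V
  head : σ.edgeSet → V
  endpoints : ∀ e, s(tail e, head e) = e.1
  head_eq_leaf : ∀ (e : σ.edgeSet) (v : V), v ∈ e.1 → IsLeaf σ v → head e = v

variable {σ : SimpleGraph V}

theorem LeafOrientation.tail_mem (o : LeafOrientation σ) (e : σ.edgeSet) : o.tail e ∈ e.1 := by
  rw [← o.endpoints e]
  exact Sym2.mem_mk_left _ _

theorem LeafOrientation.head_mem (o : LeafOrientation σ) (e : σ.edgeSet) : o.head e ∈ e.1 := by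
  rw [← o.endpoints e]
  exact Sym2.mem_mk_right _ _

theorem LeafOrientation.tail_not_leaf (o : LeafOrientation σ) (e : σ.edgeSet) :
    ¬ IsLeaf σ (o.tail e) := by
  intro h
  have h1 : o.head e = o.tail e := o.head_eq_leaf e _ (o.tail_mem e) h
  have h2 : s(o.tail e, o.head e) ∈ σ.edgeSet := by
    rw [o.endpoints e]
    exact e.2
  rw [SimpleGraph.mem_edgeSet] at h2
  exact h2.ne h1.symm

/-- The tail of an edge, as a non-leaf vertex. -/
def LeafOrientation.innerTail (o : LeafOrientation σ) (e : σ.edgeSet) : InnerVertex σ :=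
  ⟨o.tail e, o.tail_not_leaf e⟩

/-- The head of a non-leaf edge, as a non-leaf vertex. -/
def LeafOrientation.innerHead (o : LeafOrientation σ) (e : InnerEdge σ) : InnerVertex σ :=
  ⟨o.head e.1, fun h => e.2 ⟨o.head e.1, o.head_mem e.1, h⟩⟩

end Trees

/-! ### The affine variety `M(σ)` and the action of the group `G(σ)` -/

section Action

variable {V : Type} {σ : SimpleGraph V}

/-- The group `G(σ)`: one copy of `SL₂` for each non-leaf vertex. -/
abbrev GroupG (σ : SimpleGraph V) : Type :=
  InnerVertex σ → Matrix.SpecialLinearGroup (Fin 2) ℂ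

/-- The space `M(σ)`: one copy of `SL₂` for each non-leaf edge, and one copy of `𝔸²` for each
leaf-edge. The orientation is recorded since the action of `G(σ)` depends on it. -/
@[ext]
structure SpaceM (o : LeafOrientation σ) : Type where
  inner : InnerEdge σ → Matrix.SpecialLinearGroup (Fin 2) ℂ
  leaf : LeafEdge σ → (Fin 2 → ℂ)

/-- The copy of `SL₂` at `v` acts on the left of the space at an edge leaving `v`, and on the
right (through the inverse) of the space at a non-leaf edge entering `v`. -/
instance (o : LeafOrientation σ) : MulAction (GroupG σ) (SpaceM o) where
  smul g x :=
    { inner := fun e => g (o.innerTail e.1) * x.inner e * (g (o.innerHead e))⁻¹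
      leaf := fun l => (g (o.innerTail l.1)).1.mulVec (x.leaf l) }
  one_smul x := by
    refine SpaceM.ext (funext fun e => ?_) (funext fun l => ?_)
    · change (1 : Matrix.SpecialLinearGroup (Fin 2) ℂ) * x.inner e * 1⁻¹ = x.inner e
      simp
    · change (1 : Matrix.SpecialLinearGroup (Fin 2) ℂ).1.mulVec (x.leaf l) = x.leaf l
      simp
  mul_smul g h x := by
    refine SpaceM.ext (funext fun e => ?_) (funext fun l => ?_)
    · change (g _ * h _) * x.inner e * (g _ * h _)⁻¹
        = g _ * (h _ * x.inner e * (h _)⁻¹) * (g _)⁻¹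
      simp only [mul_inv_rev, mul_assoc]
    · change (g _ * h _).1.mulVec (x.leaf l) = (g _).1.mulVec ((h _).1.mulVec (x.leaf l))
      rw [Matrix.SpecialLinearGroup.coe_mul, Matrix.mulVec_mulVec]

/-- The coordinate ring `ℂ[M(σ)]`: the functions on `M(σ)` that are polynomials in the matrix
entries at the non-leaf edges and the coordinates at the leaf-edges. -/
def coordinateRing (o : LeafOrientation σ) : Subalgebra ℂ (SpaceM o → ℂ) :=
  Algebra.adjoin ℂ
    (Set.range (fun (t : InnerEdge σ × Fin 2 × Fin 2) (x : SpaceM o) =>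
        (x.inner t.1).1 t.2.1 t.2.2) ∪
      Set.range (fun (t : LeafEdge σ × Fin 2) (x : SpaceM o) => x.leaf t.1 t.2))

end Action

/-- The complex functions on `Z` that are invariant under the action of `G`. -/
def invariantFunctions (G Z : Type) [Group G] [MulAction G Z] : Subalgebra ℂ (Z → ℂ) where
  carrier := {f | ∀ (g : G) (z : Z), f (g • z) = f z}
  mul_mem' ha hb g z := by simp only [Pi.mul_apply, ha g z, hb g z]
  add_mem' ha hb g z := by simp only [Pi.add_apply, ha g z, hb g z]
  algebraMap_mem' _ _ _ := rfl

/-- `Spec A` as a scheme over `Spec ℂ`. -/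
noncomputable def specOver (A : Type) [CommRing A] [Algebra ℂ A] :
    Over (Spec (CommRingCat.of ℂ)) :=
  Over.mk (Spec.map (CommRingCat.ofHom (algebraMap ℂ A)))

/-- The GIT quotient `M(σ)//G(σ) = Spec ℂ[M(σ)]^{G(σ)}`. -/
noncomputable def gitQuotient {V : Type} {σ : SimpleGraph V} (o : LeafOrientation σ) :
    Over (Spec (CommRingCat.of ℂ)) :=
  specOver ↥(coordinateRing o ⊓ invariantFunctions (GroupG σ) (SpaceM o))

/-! ### The affine cone over the Grassmannian of planes -/

/-- The index set of the Plücker coordinates `p_{ij}`, `i < j`. -/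
abbrev PluckerIndex (n : ℕ) : Type :=
  {p : Fin n × Fin n // p.1 < p.2}

/-- The `2 × 2` minors of the matrix with rows `v` and `w`. -/
def pluckerVector {n : ℕ} (v w : Fin n → ℂ) : PluckerIndex n → ℂ :=
  fun p => v p.1.1 * w p.1.2 - v p.1.2 * w p.1.1

/-- The affine cone over the Plücker embedding of `Gr₂(ℂⁿ)`, as a set: the origin together with
the lines spanned by the Plücker vectors of the planes `W` in `ℂⁿ`. -/
def affineCone (n : ℕ) : Set (PluckerIndex n → ℂ) :=
  {0} ∪ {p | ∃ W : Submodule ℂ (Fin n → ℂ), Module.finrank ℂ W = 2 ∧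
    ∃ v w : Fin n → ℂ, Submodule.span ℂ {v, w} = W ∧ ∃ c : ℂ, p = c • pluckerVector v w}

/-- The Plücker ideal `I_{2,n}`: the polynomials in the `p_{ij}` vanishing on the affine cone. -/
noncomputable def pluckerIdeal (n : ℕ) : Ideal (MvPolynomial (PluckerIndex n) ℂ) :=
  MvPolynomial.vanishingIdeal ℂ (affineCone n)

/-- The affine variety `X`, the affine cone over `Gr₂(ℂⁿ)` in its Plücker embedding. -/
noncomputable def coneX (n : ℕ) : Over (Spec (CommRingCat.of ℂ)) :=
  specOver (MvPolynomial (PluckerIndex n) ℂ ⧸ pluckerIdeal n)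

end TreeGIT

/-! Since a tree has no cycles, the matrices at non-leaf edges can be gauged away. Fix a root `r`
and let `h v x` be the product of the edge matrices of `x` along the path from `r` to `v`. Acting on
`x` by these matrices turns every non-leaf edge into the identity, and the remaining symmetry is one
diagonal `SL₂` acting on `n` vectors (`exists_section`). Hence invariants on `M(σ)` are the same as
`SL₂`-invariants of `n` vectors in the plane. By the first fundamental theorem
(`mem_adjoin_bracket_of_invariant`, proved with Capelli's identity) these are generated by the
brackets, so sending `p_{ij}` to the bracket maps the polynomial ring onto the invariant ring. The
cone is exactly the set of Plücker vectors of pairs (`mem_affineCone_iff`), so the kernel is its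
vanishing ideal; no explicit Plücker relations are needed. -/

namespace TreeGIT

/-! ### The first fundamental theorem for `SL₂` -/

section FirstFundamentalTheorem

open MvPolynomial

variable {ι : Type}

/-- The bracket `[i j]`, a `2 × 2` minor of the generic matrix. -/
noncomputable def bracket (i j : ι) : MvPolynomial (ι × Fin 2) ℂ :=
  X (i, 0) * X (j, 1) - X (j, 0) * X (i, 1)

/-- Cayley's Omega operator. -/
noncomputable def cayleyOmega (i j : ι) (F : MvPolynomial (ι × Fin 2) ℂ) :
    MvPolynomial (ι × Fin 2) ℂ :=
  pderiv (i, 0) (pderiv (j, 1) F) - pderiv (j, 0) (pderiv (i, 1) F)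

theorem isHomogeneous_cayleyOmega (i j : ι) {F : MvPolynomial (ι × Fin 2) ℂ} {d : ℕ}
    (hF : F.IsHomogeneous d) : (cayleyOmega i j F).IsHomogeneous (d - 1 - 1) :=
  hF.pderiv.pderiv.sub hF.pderiv.pderiv

variable [Fintype ι]

/-- The polarization operator `∑ᵢ x_{i,a} ∂/∂x_{i,b}`. -/
noncomputable def polarization (a b : Fin 2) :
    Derivation ℂ (MvPolynomial (ι × Fin 2) ℂ) (MvPolynomial (ι × Fin 2) ℂ) :=
  ∑ i, (X (i, a) : MvPolynomial (ι × Fin 2) ℂ) • pderiv (i, b)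

theorem polarization_apply (a b : Fin 2) (F : MvPolynomial (ι × Fin 2) ℂ) :
    polarization a b F = ∑ i, X (i, a) * pderiv (i, b) F := by
  rw [polarization, ← Derivation.coeFnAddMonoidHom_apply, map_sum, Finset.sum_apply]
  rfl

theorem polarization_X (a b : Fin 2) (k : ι × Fin 2) :
    polarization a b (X k : MvPolynomial (ι × Fin 2) ℂ) = if k.2 = b then X (k.1, a) else 0 := by
  classical
  obtain ⟨j, c⟩ := k
  simp only [polarization_apply, pderiv_X, Pi.single_apply, Prod.mk.injEq]
  by_cases h : c = b
  · simp [h]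
  · simp [h]

theorem pderiv_comm {σ : Type} (i j : σ) (F : MvPolynomial σ ℂ) :
    pderiv i (pderiv j F) = pderiv j (pderiv i F) := by
  classical
  let D : σ → Derivation ℂ (MvPolynomial σ ℂ) (MvPolynomial σ ℂ) := pderiv
  have h : ⁅D i, D j⁆ = 0 := by
    refine derivation_ext fun k => ?_
    simp [D, Derivation.commutator_apply, pderiv_X, Pi.single_apply, apply_ite]
  have := DFunLike.congr_fun h F
  rwa [Derivation.commutator_apply, Derivation.zero_apply, sub_eq_zero] at this

theorem polarization_pderiv (a b c : Fin 2) (i : ι) (F : MvPolynomial (ι × Fin 2) ℂ) :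
    polarization a b (pderiv (i, c) F) =
      pderiv (i, c) (polarization a b F) - if c = a then pderiv (i, b) F else 0 := by
  classical
  simp only [polarization_apply, map_sum, pderiv_mul, pderiv_X, Pi.single_apply, Prod.mk.injEq,
    Finset.sum_add_distrib]
  simp only [pderiv_comm (i, c)]
  by_cases h : a = c
  · simp [h]
  · simp [h, Ne.symm h]

/-- A commutator of derivations is a derivation, so checking the variables suffices. -/
theorem polarization_commutator (F : MvPolynomial (ι × Fin 2) ℂ) :
    polarization 0 1 (polarization 1 0 F) - polarization 1 0 (polarization 0 1 F) =
      polarization 0 0 F - polarization 1 1 F := by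
  let D : Fin 2 → Fin 2 → Derivation ℂ (MvPolynomial (ι × Fin 2) ℂ)
    (MvPolynomial (ι × Fin 2) ℂ) := polarization
  have h : ⁅D 0 1, D 1 0⁆ = D 0 0 - D 1 1 := by
    refine derivation_ext fun k => ?_
    obtain ⟨j, c⟩ := k
    fin_cases c <;> simp [D, Derivation.commutator_apply, polarization_X]
  have := DFunLike.congr_fun h F
  rwa [Derivation.commutator_apply, Derivation.sub_apply] at this

theorem polarization_diag (F : MvPolynomial (ι × Fin 2) ℂ) :
    polarization 0 0 (polarization 1 1 F) =
      ∑ i : ι, ∑ j : ι, X (i, 0) * X (j, 1) * pderiv (i, 0) (pderiv (j, 1) F) := by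
  classical
  simp only [polarization_apply, map_sum, pderiv_mul, pderiv_X, Pi.single_apply, Prod.mk.injEq]
  simp [mul_assoc]
  exact Finset.sum_comm

theorem polarization_offDiag (F : MvPolynomial (ι × Fin 2) ℂ) :
    polarization 0 1 (polarization 1 0 F) = polarization 0 0 F +
      ∑ i : ι, ∑ j : ι, X (i, 0) * X (j, 1) * pderiv (j, 0) (pderiv (i, 1) F) := by
  classical
  simp only [polarization_apply, map_sum, pderiv_mul, pderiv_X, Pi.single_apply, Prod.mk.injEq]
  simp [mul_assoc, Finset.sum_add_distrib, mul_add, pderiv_comm (_, (1 : Fin 2))]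
  exact Finset.sum_comm

/-- Capelli's identity. -/
theorem capelli (F : MvPolynomial (ι × Fin 2) ℂ) :
    ∑ i : ι, ∑ j : ι, bracket i j * cayleyOmega i j F =
      2 * (polarization 0 0 (polarization 1 1 F) + polarization 0 0 F -
        polarization 0 1 (polarization 1 0 F)) := by
  rw [polarization_offDiag, polarization_diag]
  -- The second half is the first with `i` and `j` exchanged, which produces the factor 2.
  have e : ∀ i j : ι, bracket i j * cayleyOmega i j F =
      (X (i, 0) * X (j, 1) * pderiv (i, 0) (pderiv (j, 1) F) -
        X (i, 0) * X (j, 1) * pderiv (j, 0) (pderiv (i, 1) F)) +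
      (X (j, 0) * X (i, 1) * pderiv (j, 0) (pderiv (i, 1) F) -
        X (j, 0) * X (i, 1) * pderiv (i, 0) (pderiv (j, 1) F)) := by
    intro i j
    rw [bracket, cayleyOmega]
    ring
  simp only [e, Finset.sum_add_distrib]
  rw [Finset.sum_comm (f := fun i j => X (j, 0) * X (i, 1) * pderiv (j, 0) (pderiv (i, 1) F) -
        X (j, 0) * X (i, 1) * pderiv (i, 0) (pderiv (j, 1) F))]
  simp only [Finset.sum_sub_distrib]
  ring

/-- Omega commutes with the off-diagonal polarizations: the two correction terms cancel by symmetry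
of second derivatives. -/
theorem polarization_cayleyOmega {a b : Fin 2} (hab : a ≠ b) (i j : ι)
    {F : MvPolynomial (ι × Fin 2) ℂ} (hF : polarization a b F = 0) :
    polarization a b (cayleyOmega i j F) = 0 := by
  rw [cayleyOmega, map_sub]
  simp only [polarization_pderiv, hF, map_zero]
  fin_cases a <;> fin_cases b <;> simp at hab ⊢
  · rw [pderiv_comm, neg_add_cancel]
  · rw [pderiv_comm, neg_add_cancel]

theorem isHomogeneous_polarization (a b : Fin 2) {F : MvPolynomial (ι × Fin 2) ℂ} {d : ℕ}
    (hF : F.IsHomogeneous d) : (polarization a b F).IsHomogeneous d := by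
  rw [polarization_apply]
  refine IsHomogeneous.sum _ _ _ fun i _ => ?_
  rcases d with _ | d
  · obtain ⟨c, rfl⟩ : ∃ c, F = C c :=
      ⟨_, totalDegree_eq_zero_iff_eq_C.1 (by simpa using hF.totalDegree_le)⟩
    simpa using isHomogeneous_zero _ _ _
  · have := (isHomogeneous_X ℂ (i, a)).mul (hF.pderiv (i := (i, b)))
    simpa [add_comm] using this

theorem polarization_homogeneousComponent (a b : Fin 2) (F : MvPolynomial (ι × Fin 2) ℂ) (d : ℕ) :
    polarization a b (homogeneousComponent d F) = homogeneousComponent d (polarization a b F) := by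
  induction F using MvPolynomial.induction_on' with
  | monomial s c =>
    have h := isHomogeneous_monomial (R := ℂ) c (rfl : s.degree = s.degree)
    rw [homogeneousComponent_of_mem (m := d) h,
      homogeneousComponent_of_mem (m := d) (isHomogeneous_polarization a b h)]
    split_ifs <;> simp
  | add p q hp hq => simp [hp, hq]

/-- The commutator relation and Euler's formula make both diagonal polarizations act on `F` as `d /
2`. Capelli's identity then writes `d (d + 2) / 2` times `F` as a combination of brackets with
coefficients `cayleyOmega i j F`, which have smaller degree and satisfy the same hypotheses. -/
theorem mem_adjoin_bracket_of_isHomogeneous (d : ℕ) (F : MvPolynomial (ι × Fin 2) ℂ)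
    (hd : F.IsHomogeneous d) (h01 : polarization 0 1 F = 0) (h10 : polarization 1 0 F = 0) :
    F ∈ Algebra.adjoin ℂ (Set.range fun p : ι × ι => bracket p.1 p.2) := by
  induction d using Nat.strong_induction_on generalizing F with
  | _ d ih =>
  rcases Nat.eq_zero_or_pos d with rfl | hpos
  · rw [totalDegree_eq_zero_iff_eq_C.1 (Nat.le_zero.1 hd.totalDegree_le)]
    exact Subalgebra.algebraMap_mem _ _
  have hdiff : polarization 0 0 F = polarization 1 1 F := by
    have := polarization_commutator F
    rw [h01, h10, map_zero, map_zero, sub_self] at this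
    exact (sub_eq_zero.1 this.symm)
  have heuler : polarization 0 0 F + polarization 1 1 F = (d : ℂ) • F := by
    have := hd.sum_X_mul_pderiv
    rw [Fintype.sum_prod_type] at this
    simp only [Fin.sum_univ_two, Finset.sum_add_distrib] at this
    rw [polarization_apply, polarization_apply, this, Nat.cast_smul_eq_nsmul]
  have h00 : polarization 0 0 F = ((d : ℂ) / 2) • F := by
    rw [← hdiff, ← two_smul ℂ] at heuler
    rw [div_eq_inv_mul, mul_smul, ← heuler, smul_smul]
    norm_num
  have h11 := hdiff.symm.trans h00
  have hcap := capelli F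
  rw [h11, Derivation.map_smul, h00, h10, map_zero, sub_zero, smul_smul, ← add_smul,
    ← map_ofNat C 2, C_mul', smul_smul] at hcap
  have hc : (2 : ℂ) * ((d : ℂ) / 2 * ((d : ℂ) / 2) + (d : ℂ) / 2) ≠ 0 := by
    have : (2 : ℂ) * ((d : ℂ) / 2 * ((d : ℂ) / 2) + (d : ℂ) / 2) = (d * (d + 2) : ℕ) / 2 := by
      push_cast
      ring
    rw [this]
    exact div_ne_zero (Nat.cast_ne_zero.2 (by positivity)) two_ne_zero
  rw [← inv_smul_smul₀ hc F, ← hcap]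
  refine Subalgebra.smul_mem _ (Subalgebra.sum_mem _ fun i _ => Subalgebra.sum_mem _ fun j _ =>
    Subalgebra.mul_mem _ (Algebra.subset_adjoin (Set.mem_range_self (i, j))) ?_) _
  exact ih _ (by omega) _ (isHomogeneous_cayleyOmega i j hd)
    (polarization_cayleyOmega (by decide) i j h01) (polarization_cayleyOmega (by decide) i j h10)

theorem mem_adjoin_bracket (F : MvPolynomial (ι × Fin 2) ℂ)
    (h01 : polarization 0 1 F = 0) (h10 : polarization 1 0 F = 0) :
    F ∈ Algebra.adjoin ℂ (Set.range fun p : ι × ι => bracket p.1 p.2) := by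
  rw [← sum_homogeneousComponent F]
  refine Subalgebra.sum_mem _ fun d _ => mem_adjoin_bracket_of_isHomogeneous d _
    (homogeneousComponent_isHomogeneous d F) ?_ ?_
  · rw [polarization_homogeneousComponent, h01, map_zero]
  · rw [polarization_homogeneousComponent, h10, map_zero]

theorem derivative_aeval {σ : Type} [Fintype σ] (f : σ → Polynomial ℂ) (F : MvPolynomial σ ℂ) :
    Polynomial.derivative (aeval f F) =
      ∑ i, aeval f (pderiv i F) * Polynomial.derivative (f i) := by
  classical
  induction F using MvPolynomial.induction_on with
  | C a => simp
  | add p q hp hq => simp [hp, hq, add_mul, Finset.sum_add_distrib]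
  | mul_X p k hp =>
    simp only [map_mul, aeval_X, Polynomial.derivative_mul, hp, pderiv_mul, pderiv_X, map_add,
      add_mul, Finset.sum_add_distrib, Pi.single_apply]
    congr 1
    · rw [Finset.sum_mul]
      exact Finset.sum_congr rfl fun i _ => by ring
    · simp [apply_ite]

/-- Infinitesimal invariance: along the transvections `1 + t E_{ba}` the value of `F` is a constant
polynomial in `t`, and its derivative at `t = 0` is the polarization. -/
theorem polarization_eq_zero {a b : Fin 2} (hab : a ≠ b) (F : MvPolynomial (ι × Fin 2) ℂ)
    (hF : ∀ (g : Matrix.SpecialLinearGroup (Fin 2) ℂ) (y : ι → Fin 2 → ℂ),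
      eval (fun k => (g.1.mulVec (y k.1)) k.2) F = eval (fun k => y k.1 k.2) F) :
    polarization a b F = 0 := by
  classical
  refine MvPolynomial.funext fun z => ?_
  let f : ι × Fin 2 → Polynomial ℂ := fun k =>
    Polynomial.C (z k) + Polynomial.C (if k.2 = b then z (k.1, a) else 0) * Polynomial.X
  have heval : ∀ (t : ℂ) (G : MvPolynomial (ι × Fin 2) ℂ), (aeval f G).eval t =
      eval (fun k => z k + (if k.2 = b then z (k.1, a) else 0) * t) G := by
    intro t G
    have : (Polynomial.aeval t).comp (aeval f) =
        aeval (fun k => z k + (if k.2 = b then z (k.1, a) else 0) * t) := by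
      refine algHom_ext fun k => ?_
      simp only [AlgHom.comp_apply, aeval_X, f]
      simp
    simpa [Polynomial.coe_aeval_eq_eval, aeval_eq_eval] using DFunLike.congr_fun this G
  have hconst : aeval f F = Polynomial.C (eval z F) := by
    refine Polynomial.funext fun t => ?_
    rw [heval, Polynomial.eval_C]
    have := hF ⟨Matrix.transvection b a t, Matrix.det_transvection_of_ne b a hab.symm t⟩
      fun i c => z (i, c)
    rw [← show (fun k : ι × Fin 2 => z (k.1, k.2)) = z from rfl, ← this]
    congr 2
    funext k
    obtain ⟨i, c⟩ := k
    simp only [Matrix.transvection, Matrix.add_mulVec, Matrix.one_mulVec, Pi.add_apply,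
      Matrix.single_mulVec_eq]
    by_cases h : c = b
    · simp [h, mul_comm]
    · simp [h]
  have hder := congrArg (Polynomial.eval 0) (derivative_aeval f F)
  rw [hconst, Polynomial.derivative_C, Polynomial.eval_zero, Polynomial.eval_finsetSum] at hder
  rw [map_zero, hder, polarization_apply, map_sum, Fintype.sum_prod_type]
  refine Finset.sum_congr rfl fun i _ => ?_
  -- Only the coordinates with second index `b` move with `t`.
  rw [Finset.sum_eq_single b]
  · rw [Polynomial.eval_mul, heval]
    simp only [mul_zero, add_zero, f]
    simp
    exact mul_comm _ _
  · intro c _ hc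
    simp [f, hc]
  · simp

/-- The first fundamental theorem of invariant theory for `SL₂`. -/
theorem mem_adjoin_bracket_of_invariant (F : MvPolynomial (ι × Fin 2) ℂ)
    (hF : ∀ (g : Matrix.SpecialLinearGroup (Fin 2) ℂ) (y : ι → Fin 2 → ℂ),
      eval (fun k => (g.1.mulVec (y k.1)) k.2) F = eval (fun k => y k.1 k.2) F) :
    F ∈ Algebra.adjoin ℂ (Set.range fun p : ι × ι => bracket p.1 p.2) :=
  mem_adjoin_bracket F (polarization_eq_zero (by decide) F hF)
    (polarization_eq_zero (by decide) F hF)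

end FirstFundamentalTheorem

/-! ### Potentials on trees -/

section Potential

variable {V : Type} {σ : SimpleGraph V} {G : Type} [Group G]

/-- The ordered product of the values of `T` along a walk. -/
def holonomy (T : V → V → G) {a b : V} : σ.Walk a b → G
  | .nil => 1
  | .cons (v := c) _ p => T a c * holonomy T p

theorem holonomy_concat (T : V → V → G) {a b c : V} (p : σ.Walk a b) (h : σ.Adj b c) :
    holonomy T (p.concat h) = holonomy T p * T b c := by
  induction p with
  | nil => simp [SimpleGraph.Walk.concat_nil, holonomy]
  | cons h' p ih => simp [SimpleGraph.Walk.concat_cons, holonomy, ih, mul_assoc]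

/-- The potential at `v` is the holonomy along the unique path from `r` to `v`. -/
theorem exists_vertex_potential (hσ : σ.IsTree) (T : V → V → G)
    (hT : ∀ a b, σ.Adj a b → T b a = (T a b)⁻¹) (r : V) :
    ∃ h : V → G, h r = 1 ∧ ∀ a b, σ.Adj a b → h a * T a b = h b := by
  choose P hP hu using hσ.existsUnique_path r
  refine ⟨fun v => holonomy T (P v), ?_, fun a b hab => ?_⟩
  · change holonomy T (P r) = 1
    rw [← hu r .nil .nil]
    rfl
  -- Either the path to `a` ends with the edge from `b`, or appending the edge to `b` gives the path
  -- to `b`.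
  · by_cases hb : b ∈ (P a).support
    · have := hσ.isAcyclic.path_concat (hP b) (hP a) hab.symm hb
      dsimp only
      rw [this, holonomy_concat, hT a b hab]
      simp
    · dsimp only
      rw [← hu b _ ((hP a).concat hb hab), holonomy_concat]

theorem LeafOrientation.adj (o : LeafOrientation σ) (e : σ.edgeSet) :
    σ.Adj (o.tail e) (o.head e) := by
  rw [← SimpleGraph.mem_edgeSet, o.endpoints e]
  exact e.2

theorem LeafOrientation.exists_edge (o : LeafOrientation σ) {a b : V} (h : σ.Adj a b) :
    ∃ e, (o.tail e = a ∧ o.head e = b) ∨ (o.tail e = b ∧ o.head e = a) := by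
  refine ⟨⟨s(a, b), h⟩, ?_⟩
  have := o.endpoints ⟨s(a, b), h⟩
  simpa using this

theorem exists_potential (hσ : σ.IsTree) (o : LeafOrientation σ) (m : σ.edgeSet → G) (r : V) :
    ∃ h : V → G, h r = 1 ∧ ∀ e, h (o.tail e) * m e = h (o.head e) := by
  classical
  let T : V → V → G := fun a b =>
    if h : σ.Adj a b then
      if o.tail ⟨s(a, b), h⟩ = a then m ⟨s(a, b), h⟩ else (m ⟨s(a, b), h⟩)⁻¹
    else 1
  have h1 : ∀ e, T (o.tail e) (o.head e) = m e := by
    intro e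
    have : (⟨s(o.tail e, o.head e), o.adj e⟩ : σ.edgeSet) = e := Subtype.ext (o.endpoints e)
    simp only [T, dif_pos (o.adj e), this, if_true]
  have h2 : ∀ e, T (o.head e) (o.tail e) = (m e)⁻¹ := by
    intro e
    have : (⟨s(o.head e, o.tail e), (o.adj e).symm⟩ : σ.edgeSet) = e :=
      Subtype.ext (Sym2.eq_swap.trans (o.endpoints e))
    simp only [T, dif_pos (o.adj e).symm, this, if_neg (o.adj e).ne]
  obtain ⟨h, hr, hh⟩ := exists_vertex_potential hσ T (fun a b hab => by
    obtain ⟨e, ⟨rfl, rfl⟩ | ⟨rfl, rfl⟩⟩ := o.exists_edge hab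
    · rw [h1, h2]
    · rw [h1, h2, inv_inv]) r
  exact ⟨h, hr, fun e => by rw [← hh _ _ (o.adj e), h1]⟩

/-- Induction over a connected graph; it serves to prove polynomiality, equivariance and
normalization of the potential. -/
theorem forall_vertex_of_edges (hσ : σ.IsTree) (o : LeafOrientation σ) {P : V → Prop} {r : V}
    (hr : P r) (hP : ∀ e, P (o.tail e) ↔ P (o.head e)) (v : V) : P v := by
  obtain ⟨p⟩ := hσ.connected.preconnected r v
  induction p with
  | nil => exact hr
  | cons h p ih =>
    refine ih ?_
    obtain ⟨e, ⟨rfl, rfl⟩ | ⟨rfl, rfl⟩⟩ := o.exists_edge h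
    · exact (hP e).1 hr
    · exact (hP e).2 hr

end Potential

/-! ### Leaves and leaf-edges -/

section Leaves

variable {V : Type} {σ : SimpleGraph V}

theorem LeafOrientation.isLeaf_head (o : LeafOrientation σ) (l : LeafEdge σ) :
    IsLeaf σ (o.head l.1) := by
  obtain ⟨v, hv, hl⟩ := l.2
  rwa [o.head_eq_leaf l.1 v hv hl]

theorem LeafOrientation.head_injective (o : LeafOrientation σ) :
    Function.Injective fun l : LeafEdge σ => o.head l.1 := by
  intro l l' h
  dsimp only at h
  obtain ⟨w, hw⟩ := Set.ncard_eq_one.1 (o.isLeaf_head l)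
  have h1 : o.tail l.1 ∈ σ.neighborSet (o.head l.1) := (o.adj l.1).symm
  have h2 : o.tail l'.1 ∈ σ.neighborSet (o.head l.1) := h ▸ (o.adj l'.1).symm
  rw [hw, Set.mem_singleton_iff] at h1 h2
  refine Subtype.ext (Subtype.ext ?_)
  rw [← o.endpoints l.1, ← o.endpoints l'.1, h, h1, h2]

theorem LeafOrientation.bijective_leaf (o : LeafOrientation σ) :
    Function.Bijective fun l : LeafEdge σ =>
      (⟨o.head l.1, o.isLeaf_head l⟩ : {v : V // IsLeaf σ v}) := by
  refine ⟨fun l l' h => o.head_injective (congrArg Subtype.val h), fun ⟨v, hv⟩ => ?_⟩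
  obtain ⟨w, hw⟩ := Set.ncard_eq_one.1 hv
  have hadj : σ.Adj v w := by
    rw [← SimpleGraph.mem_neighborSet, hw]
    rfl
  refine ⟨⟨⟨s(v, w), hadj⟩, v, Sym2.mem_mk_left _ _, hv⟩, Subtype.ext ?_⟩
  exact o.head_eq_leaf _ v (Sym2.mem_mk_left _ _) hv

open Classical in
/-- The extension of an element of `G(σ)` to all vertices that is constant along leaf-edges. -/
noncomputable def LeafOrientation.extend (o : LeafOrientation σ) (g : GroupG σ) (v : V) :
    Matrix.SpecialLinearGroup (Fin 2) ℂ :=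
  if h : ∃ l : LeafEdge σ, o.head l.1 = v then g (o.innerTail h.choose.1)
  -- The final value 1 is never taken, as every leaf is the head of its leaf-edge.
  else if h : ¬ IsLeaf σ v then g ⟨v, h⟩ else 1

theorem LeafOrientation.extend_head (o : LeafOrientation σ) (g : GroupG σ) (l : LeafEdge σ) :
    o.extend g (o.head l.1) = g (o.innerTail l.1) := by
  have h : ∃ l' : LeafEdge σ, o.head l'.1 = o.head l.1 := ⟨l, rfl⟩
  rw [extend, dif_pos h, o.head_injective h.choose_spec]

theorem LeafOrientation.extend_of_not_isLeaf (o : LeafOrientation σ) (g : GroupG σ) {v : V}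
    (hv : ¬ IsLeaf σ v) : o.extend g v = g ⟨v, hv⟩ := by
  rw [extend, dif_neg, dif_pos hv]
  rintro ⟨l, rfl⟩
  exact hv (o.isLeaf_head l)

end Leaves

/-! ### Reduction to the diagonal action of `SL₂` on `(𝔸²)ⁿ` -/

section Reduction

variable {V : Type} {σ : SimpleGraph V}

@[simp]
theorem smul_inner {o : LeafOrientation σ} (g : GroupG σ) (x : SpaceM o) (e : InnerEdge σ) :
    (g • x).inner e = g (o.innerTail e.1) * x.inner e * (g (o.innerHead e))⁻¹ := rfl

@[simp]
theorem smul_leaf {o : LeafOrientation σ} (g : GroupG σ) (x : SpaceM o) (l : LeafEdge σ) :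
    (g • x).leaf l = (g (o.innerTail l.1)).1.mulVec (x.leaf l) := rfl

open Classical in
/-- The component at an edge, taken to be trivial at the leaf-edges. -/
noncomputable def edgeValue (o : LeafOrientation σ) (e : σ.edgeSet) (x : SpaceM o) :
    Matrix.SpecialLinearGroup (Fin 2) ℂ :=
  if h : IsLeafEdge σ e then 1 else x.inner ⟨e, h⟩

theorem edgeValue_inner {o : LeafOrientation σ} (e : InnerEdge σ) (x : SpaceM o) :
    edgeValue o e.1 x = x.inner e := dif_neg e.2

/-- Extending `g` to the leaves gives all edges one transformation law, since a leaf-edge then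
carries `g * 1 * g⁻¹ = 1`. -/
theorem edgeValue_smul {o : LeafOrientation σ} (g : GroupG σ) (x : SpaceM o) (e : σ.edgeSet) :
    edgeValue o e (g • x) =
      o.extend g (o.tail e) * edgeValue o e x * (o.extend g (o.head e))⁻¹ := by
  rw [o.extend_of_not_isLeaf g (o.tail_not_leaf e)]
  by_cases h : IsLeafEdge σ e
  · rw [o.extend_head g ⟨e, h⟩, edgeValue, edgeValue, dif_pos h, dif_pos h, mul_one]
    exact (mul_inv_cancel _).symm
  · rw [edgeValue_inner ⟨e, h⟩, edgeValue_inner ⟨e, h⟩, smul_inner,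
      o.extend_of_not_isLeaf g (v := o.head e) (o.innerHead ⟨e, h⟩).2]
    rfl

/-- The maps to `SL₂` whose entries are in the coordinate ring. -/
def polynomialMaps (o : LeafOrientation σ) :
    Subgroup (SpaceM o → Matrix.SpecialLinearGroup (Fin 2) ℂ) where
  carrier := {h | ∀ i j, (fun x => (h x).1 i j) ∈ coordinateRing o}
  one_mem' i j := Subalgebra.algebraMap_mem _ ((1 : Matrix (Fin 2) (Fin 2) ℂ) i j)
  mul_mem' {a b} ha hb i j := by
    have : (fun x => ((a * b) x).1 i j) =
        (fun x => (a x).1 i 0) * (fun x => (b x).1 0 j) +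
          (fun x => (a x).1 i 1) * (fun x => (b x).1 1 j) := by
      funext x
      simp [Matrix.mul_apply, Fin.sum_univ_two]
    rw [this]
    exact add_mem (mul_mem (ha _ _) (hb _ _)) (mul_mem (ha _ _) (hb _ _))
  inv_mem' {a} ha i j := by
    -- In `SL₂` the inverse is the adjugate, hence polynomial in the entries.
    have h : ∀ x, ((a⁻¹) x).1 = !![(a x).1 1 1, -(a x).1 0 1; -(a x).1 1 0, (a x).1 0 0] := by
      intro x
      rw [← Matrix.adjugate_fin_two]
      rfl
    simp only [h]
    fin_cases i <;> fin_cases j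
    · exact ha 1 1
    · exact neg_mem (ha 0 1)
    · exact neg_mem (ha 1 0)
    · exact ha 0 0

theorem edgeValue_mem (o : LeafOrientation σ) (e : σ.edgeSet) :
    edgeValue o e ∈ polynomialMaps o := by
  by_cases h : IsLeafEdge σ e
  · have : edgeValue o e = 1 := funext fun x => dif_pos h
    rw [this]
    exact one_mem _
  · have : edgeValue o e = fun x => x.inner ⟨e, h⟩ := funext fun x => dif_neg h
    rw [this]
    exact fun i j => Algebra.subset_adjoin (Or.inl ⟨(⟨e, h⟩, i, j), rfl⟩)

theorem leaf_mem (o : LeafOrientation σ) (l : LeafEdge σ) (i : Fin 2) :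
    (fun x : SpaceM o => x.leaf l i) ∈ coordinateRing o :=
  Algebra.subset_adjoin (Or.inr ⟨(l, i), rfl⟩)

/-- Gauge fixing: `Φ` transports the leaf vectors to the root, and `s` puts identity matrices on the
non-leaf edges. The section `s` meets every orbit, and constant elements of `G(σ)` act on it as the
diagonal `SL₂`. -/
theorem exists_section {n : ℕ} (hσ : σ.IsTree) (o : LeafOrientation σ)
    (lab : Fin n ≃ LeafEdge σ) :
    ∃ (Φ : SpaceM o → Fin n → Fin 2 → ℂ) (s : (Fin n → Fin 2 → ℂ) → SpaceM o),
      (∀ i c, (fun x => Φ x i c) ∈ coordinateRing o) ∧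
      (∀ (g : GroupG σ) x, ∃ c : Matrix.SpecialLinearGroup (Fin 2) ℂ,
        ∀ i, Φ (g • x) i = c.1.mulVec (Φ x i)) ∧
      (∀ x, ∃ g : GroupG σ, g • x = s (Φ x)) ∧
      (∀ (c : Matrix.SpecialLinearGroup (Fin 2) ℂ) y, ∃ g : GroupG σ,
        s (fun i => c.1.mulVec (y i)) = g • s y) ∧
      (∀ y, Φ (s y) = y) ∧
      (∀ f ∈ coordinateRing o, ∃ F : MvPolynomial (Fin n × Fin 2) ℂ,
        ∀ y, f (s y) = MvPolynomial.eval (fun k => y k.1 k.2) F) := by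
  obtain ⟨r⟩ := hσ.connected.nonempty
  -- The group here is that of all maps from `SpaceM o` to `SL₂`, so a single potential handles all
  -- points `x` at once.
  obtain ⟨h, hr, hh⟩ := exists_potential hσ o (edgeValue o) r
  have hh' : ∀ e x, h (o.tail e) x * edgeValue o e x = h (o.head e) x :=
    fun e x => congrFun (hh e) x
  have hpoly : ∀ v, h v ∈ polynomialMaps o :=
    forall_vertex_of_edges hσ o (hr ▸ one_mem _) fun e => by
      rw [← hh e, Subgroup.mul_mem_cancel_right _ (edgeValue_mem o e)]
  have hequi : ∀ (g : GroupG σ) (x : SpaceM o) v,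
      h v (g • x) = o.extend g r * h v x * (o.extend g v)⁻¹ := by
    intro g x
    refine forall_vertex_of_edges hσ o (r := r) (by simp [hr]) fun e => ?_
    rw [← hh' e, ← hh' e, edgeValue_smul, ← mul_left_inj
      (o.extend g (o.tail e) * edgeValue o e x * (o.extend g (o.head e))⁻¹)]
    simp only [mul_assoc, inv_mul_cancel_left]
  let s : (Fin n → Fin 2 → ℂ) → SpaceM o := fun y => ⟨1, fun l => y (lab.symm l)⟩
  have hs : ∀ y v, h v (s y) = 1 := by
    intro y
    refine forall_vertex_of_edges hσ o (r := r) (by simp [hr]) fun e => ?_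
    have : edgeValue o e (s y) = 1 := by
      rw [edgeValue]
      split_ifs <;> rfl
    rw [← hh' e, this, mul_one]
  refine ⟨fun x i => (h (o.tail (lab i).1) x).1.mulVec (x.leaf (lab i)), s, ?_, ?_, ?_, ?_, ?_, ?_⟩
  · intro i c
    simp only [Matrix.mulVec, dotProduct, Fin.sum_univ_two]
    exact add_mem (mul_mem (hpoly _ _ _) (leaf_mem _ _ _)) (mul_mem (hpoly _ _ _) (leaf_mem _ _ _))
  · refine fun g x => ⟨o.extend g r, fun i => ?_⟩
    dsimp only
    rw [hequi, o.extend_of_not_isLeaf g (o.tail_not_leaf _), smul_leaf, Matrix.mulVec_mulVec,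
      Matrix.mulVec_mulVec, ← Matrix.SpecialLinearGroup.coe_mul,
      ← Matrix.SpecialLinearGroup.coe_mul]
    exact congrArg (fun c : Matrix.SpecialLinearGroup (Fin 2) ℂ => c.1.mulVec (x.leaf (lab i)))
      (inv_mul_cancel_right _ _)
  -- The potential at `x` is itself the group element that trivializes `x`.
  · refine fun x => ⟨fun v => h v.1 x, SpaceM.ext (funext fun e => ?_) (funext fun l => ?_)⟩
    · rw [smul_inner, ← edgeValue_inner]
      exact mul_inv_eq_one.2 (hh' e.1 x)
    · rw [smul_leaf]
      simp only [s, Equiv.apply_symm_apply]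
      rfl
  · refine fun c y => ⟨fun _ => c, SpaceM.ext (funext fun e => ?_) (funext fun l => rfl)⟩
    rw [smul_inner]
    exact (mul_inv_eq_one.2 (mul_one c)).symm
  · refine fun y => funext fun i => ?_
    simp only [hs]
    simp [s]
  · intro f hf
    induction hf using Algebra.adjoin_induction with
    | mem f hf =>
      rcases hf with ⟨t, rfl⟩ | ⟨t, rfl⟩
      · exact ⟨.C ((1 : Matrix (Fin 2) (Fin 2) ℂ) t.2.1 t.2.2), fun y => by simp [s]⟩
      · exact ⟨.X (lab.symm t.1, t.2), fun y => by simp [s]⟩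
    | algebraMap c => exact ⟨.C c, fun y => by simp⟩
    | add f f' _ _ hf hf' =>
      obtain ⟨F, hF⟩ := hf
      obtain ⟨F', hF'⟩ := hf'
      exact ⟨F + F', fun y => by simp [hF, hF']⟩
    | mul f f' _ _ hf hf' =>
      obtain ⟨F, hF⟩ := hf
      obtain ⟨F', hF'⟩ := hf'
      exact ⟨F * F', fun y => by simp [hF, hF']⟩

end Reduction

/-! ### The affine cone as the image of the Plücker map -/

section Cone

theorem smul_pluckerVector {n : ℕ} (c : ℂ) (v w : Fin n → ℂ) :
    c • pluckerVector v w = pluckerVector (c • v) w := by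
  funext p
  simp only [pluckerVector, Pi.smul_apply, smul_eq_mul]
  ring

/-- Cramer's rule: the coefficients of a linear relation are annihilated by every minor. -/
theorem linearIndependent_of_pluckerVector_ne_zero {n : ℕ} {v w : Fin n → ℂ}
    (h : pluckerVector v w ≠ 0) : LinearIndependent ℂ ![v, w] := by
  rw [LinearIndependent.pair_iff]
  intro s t hst
  have key : ∀ p : PluckerIndex n, s * pluckerVector v w p = 0 ∧ t * pluckerVector v w p = 0 := by
    intro p
    have h1 := congrFun hst p.1.1
    have h2 := congrFun hst p.1.2
    simp only [Pi.add_apply, Pi.smul_apply, smul_eq_mul, Pi.zero_apply] at h1 h2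
    constructor <;> rw [pluckerVector]
    · linear_combination w p.1.2 * h1 - w p.1.1 * h2
    · linear_combination v p.1.1 * h2 - v p.1.2 * h1
  obtain ⟨p, hp⟩ := Function.ne_iff.1 h
  exact ⟨(mul_eq_zero.1 (key p).1).resolve_right hp, (mul_eq_zero.1 (key p).2).resolve_right hp⟩

/-- The scalar is absorbed into `v`; dependent pairs give the origin, and a nonzero Plücker vector
forces a span of dimension 2. -/
theorem mem_affineCone_iff {n : ℕ} {p : PluckerIndex n → ℂ} :
    p ∈ affineCone n ↔ ∃ v w, p = pluckerVector v w := by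
  constructor
  · rintro (h | ⟨_, _, v, w, _, c, rfl⟩)
    · refine ⟨0, 0, ?_⟩
      rw [Set.mem_singleton_iff.1 h]
      funext q
      simp [pluckerVector]
    · exact ⟨c • v, w, smul_pluckerVector c v w⟩
  · rintro ⟨v, w, rfl⟩
    by_cases h : pluckerVector v w = 0
    · exact Or.inl h
    · refine Or.inr ⟨_, ?_, v, w, rfl, 1, (one_smul _ _).symm⟩
      have := finrank_span_eq_card (linearIndependent_of_pluckerVector_ne_zero h)
      rwa [Matrix.range_cons_cons_empty, Fintype.card_fin] at this

end Cone

/-- Isomorphic algebras have isomorphic spectra. -/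
noncomputable def specOverIso {A B : Type} [CommRing A] [Algebra ℂ A] [CommRing B] [Algebra ℂ B]
    (e : A ≃ₐ[ℂ] B) : specOver A ≅ specOver B :=
  Over.isoMk (Scheme.Spec.mapIso e.symm.toRingEquiv.toCommRingCatIso.op) (by
    change Spec.map _ ≫ Spec.map _ = Spec.map _
    rw [← Spec.map_comp]
    congr 1
    ext c
    exact e.symm.commutes c)

/-! ### The invariant ring as the homogeneous coordinate ring of the Grassmannian -/

section Main

variable {V : Type} {σ : SimpleGraph V}

theorem aeval_pi_apply {κ Z : Type} (f : κ → Z → ℂ) (P : MvPolynomial κ ℂ) (x : Z) :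
    MvPolynomial.aeval f P x = MvPolynomial.eval (fun k => f k x) P := by
  have := MvPolynomial.comp_aeval_apply (R := ℂ) f (Pi.evalAlgHom ℂ (fun _ : Z => ℂ) x) P
  simpa [MvPolynomial.aeval_eq_eval] using this

theorem nonempty_invariants_algEquiv {n : ℕ} (hσ : σ.IsTree) (o : LeafOrientation σ)
    (lab : Fin n ≃ LeafEdge σ) :
    Nonempty (↥(coordinateRing o ⊓ invariantFunctions (GroupG σ) (SpaceM o)) ≃ₐ[ℂ]
      (MvPolynomial (PluckerIndex n) ℂ ⧸ pluckerIdeal n)) := by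
  obtain ⟨Φ, s, hΦ, hequi, hgs, hsg, hs, hpull⟩ := exists_section hσ o lab
  let Ψ : MvPolynomial (PluckerIndex n) ℂ →ₐ[ℂ] (SpaceM o → ℂ) :=
    MvPolynomial.aeval fun p x => pluckerVector (fun i => Φ x i 0) (fun i => Φ x i 1) p
  have hΨ : ∀ P x, Ψ P x =
      MvPolynomial.eval (pluckerVector (fun i => Φ x i 0) (fun i => Φ x i 1)) P :=
    fun P x => aeval_pi_apply _ P x
  have hker : RingHom.ker Ψ = pluckerIdeal n := by
    ext P
    rw [RingHom.mem_ker, pluckerIdeal, MvPolynomial.mem_vanishingIdeal_iff]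
    constructor
    · intro h p hp
      obtain ⟨v, w, rfl⟩ := mem_affineCone_iff.1 hp
      -- Because `Φ (s y) = y`, every pair `v`, `w` arises from a point of `M(σ)`.
      have := congrFun h (s fun i => ![v i, w i])
      rw [hΨ, hs] at this
      simpa [MvPolynomial.aeval_eq_eval] using this
    · intro h
      funext x
      rw [hΨ, ← MvPolynomial.aeval_eq_eval]
      exact h _ (mem_affineCone_iff.2 ⟨_, _, rfl⟩)
  have hrange : Ψ.range = coordinateRing o ⊓ invariantFunctions (GroupG σ) (SpaceM o) := by
    apply le_antisymm
    · rw [← Algebra.map_top, ← MvPolynomial.adjoin_range_X, AlgHom.map_adjoin]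
      refine Algebra.adjoin_le ?_
      rintro _ ⟨_, ⟨p, rfl⟩, rfl⟩
      have hp : Ψ (MvPolynomial.X p) =
          (fun x => Φ x p.1.1 0) * (fun x => Φ x p.1.2 1) -
            (fun x => Φ x p.1.2 0) * (fun x => Φ x p.1.1 1) := by
        funext x
        simp [hΨ, pluckerVector]
      refine ⟨?_, fun g x => ?_⟩
      · change Ψ (MvPolynomial.X p) ∈ coordinateRing o
        rw [hp]
        exact sub_mem (mul_mem (hΦ _ _) (hΦ _ _)) (mul_mem (hΦ _ _) (hΦ _ _))
      · obtain ⟨c, hc⟩ := hequi g x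
        have hdet := c.2
        rw [Matrix.det_fin_two] at hdet
        change Ψ (MvPolynomial.X p) (g • x) = Ψ (MvPolynomial.X p) x
        rw [hp]
        simp only [Pi.sub_apply, Pi.mul_apply, hc, Matrix.mulVec, dotProduct, Fin.sum_univ_two]
        -- A minor is multiplied by `det c = 1`.
        linear_combination (Φ x p.1.1 0 * Φ x p.1.2 1 - Φ x p.1.2 0 * Φ x p.1.1 1) * hdet
    · rintro f ⟨hf, hinv⟩
      obtain ⟨F, hF⟩ := hpull f hf
      have hFinv := mem_adjoin_bracket_of_invariant F fun c y => by
        obtain ⟨g, hg⟩ := hsg c y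
        rw [← hF y, ← hinv g (s y), ← hg, hF]
      let θ : MvPolynomial (Fin n × Fin 2) ℂ →ₐ[ℂ] (SpaceM o → ℂ) :=
        MvPolynomial.aeval fun k x => Φ x k.1 k.2
      -- An invariant is recovered from its restriction `F` to the section, since `x` and `s (Φ x)`
      -- share an orbit.
      have hθ : θ F = f := by
        funext x
        obtain ⟨g, hg⟩ := hgs x
        rw [← hinv g x, hg, hF]
        exact aeval_pi_apply _ F x
      have hle : Algebra.adjoin ℂ (Set.range fun p : Fin n × Fin n => bracket p.1 p.2) ≤
          Ψ.range.comap θ := by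
        refine Algebra.adjoin_le ?_
        rintro _ ⟨⟨i, j⟩, rfl⟩
        have hlt : ∀ i j : Fin n, i < j → θ (bracket i j) ∈ Ψ.range := by
          refine fun i j hij => ⟨MvPolynomial.X ⟨(i, j), hij⟩, ?_⟩
          funext x
          simp [θ, Ψ, bracket, pluckerVector]
        change θ (bracket i j) ∈ Ψ.range
        rcases lt_trichotomy i j with h | rfl | h
        · exact hlt i j h
        · rw [bracket, sub_self, map_zero]
          exact zero_mem _
        · rw [show (bracket i j : MvPolynomial (Fin n × Fin 2) ℂ) = -bracket j i from
            (neg_sub _ _).symm, map_neg]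
          exact neg_mem (hlt j i h)
      rw [← hθ]
      exact hle hFinv
  exact ⟨((Ideal.quotientEquivAlgOfEq ℂ hker.symm).trans
    ((Ideal.quotientKerEquivRange Ψ).trans (Subalgebra.equivOfEq _ _ hrange))).symm⟩

end Main

end TreeGIT

theorem mainTheorem5 {V : Type} [Finite V] (σ : SimpleGraph V) (hσ : σ.IsTree)
    (n : ℕ) (label : Fin n ≃ {v : V // TreeGIT.IsLeaf σ v})
    (o : TreeGIT.LeafOrientation σ) :
    Nonempty (TreeGIT.gitQuotient o ≅ TreeGIT.coneX n) := by
  obtain ⟨e⟩ := TreeGIT.nonempty_invariants_algEquiv hσ o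
    (label.trans (Equiv.ofBijective _ o.bijective_leaf).symm)
  exact ⟨TreeGIT.specOverIso e⟩
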